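/- Let $X$ be an order complete (Dedekind complete) real vector lattice, and let $X^s$ be a sup-completion of $X$, in the following sense. A cone is a commutative monoid $(C,+,0)$ with a scalar multiplication $\mathbb R_+\times C\to C$ satisfying $\lambda(a+b)=\lambda a+\lambda b$, $(\lambda+\mu)a=\lambda a+\mu a$, $\lambda(\mu a)=(\lambda\mu)a$, $1a=a$ and $0a=0$; let $C_0$ be the set of its invertible elements, which is a real vector space. The cone $C$ is a sup-completion of $X$ if $X=C_0$ (as an ordered vector space) and the following hold. 1. $C$ carries a partial order such that $a\le b$ implies $a+c\le b+c$ and $\lambda a\le\lambda b$ for all $c\in C$, $\lambda\in\mathbb R_+$. 2. $C$ is a lattice under this order. 3. $C$ has a greatest element. 4. If $x\in C_0$, $a\in C$ and $a\le x$, then $a\in C_0$. 5. Every non-empty subset of $C$ has a supremum, and every subset of $C$ that is bounded below has an infimum. 6. $a=\sup\{x\in C_0 : x\le a\}$ for every $a\in C$. 7. $a+(x\wedge b)=(a+x)\wedge(a+b)$ for all $a,b\in C$ and $x\in C_0$. 8. If $A,B\subseteq C$ are non-empty, $\sup A=\sup B$ and $x\in C_0$, then $\sup\{a\wedge x : a\in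 A\}=\sup\{b\wedge x : b\in B\}$. Let $e\in X_+$ be a weak unit, that is, $x=0$ is the only $x\in X$ with $|x|\wedge e=0$. Then for every $u\in X^s$ with $u\ge 0$, $$u=\sup_{n\in\mathbb N}\,(ne\wedge u),$$ where the supremum and the infima $ne\wedge u$ are taken in $X^s$. -/

import Mathlib

open scoped NNReal

/-- A weak unit of a vector lattice: a positive vector `e` such that zero is the only vector
disjoint from `e`. -/
def IsWeakUnit {X : Type*} [AddCommGroup X] [Lattice X] (e : X) : Prop :=
  0 ≤ e ∧ ∀ x : X, |x| ⊓ e = 0 → x = 0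

/-- The conditions imposed on a cone `C` (a commutative monoid with a multiplication by
non-negative reals, i.e. an `ℝ≥0`-module) with a lattice order. The set `C₀` of the invertible
elements of `C` is `{x | IsAddUnit x}`. -/
structure IsSupCompletionCone (C : Type*) [AddCommMonoid C] [Module ℝ≥0 C] [Lattice C] :
    Prop where
  add_le_add_right : ∀ a b c : C, a ≤ b → a + c ≤ b + c
  smul_le_smul : ∀ (r : ℝ≥0) (a b : C), a ≤ b → r • a ≤ r • b
  exists_greatest : ∃ t : C, ∀ a : C, a ≤ t
  isAddUnit_of_le : ∀ a x : C, IsAddUnit x → a ≤ x → IsAddUnit a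
  exists_isLUB : ∀ A : Set C, A.Nonempty → ∃ s, IsLUB A s
  exists_isGLB : ∀ A : Set C, BddBelow A → ∃ i, IsGLB A i
  isLUB_addUnits_le : ∀ a : C, IsLUB {x : C | IsAddUnit x ∧ x ≤ a} a
  add_inf : ∀ a b x : C, IsAddUnit x → a + x ⊓ b = (a + x) ⊓ (a + b)
  isLUB_inf_congr : ∀ A B : Set C, A.Nonempty → B.Nonempty →
    ∀ s : C, IsLUB A s → IsLUB B s → ∀ x : C, IsAddUnit x →
      ∃ t : C, IsLUB ((fun a => a ⊓ x) '' A) t ∧ IsLUB ((fun b => b ⊓ x) '' B) t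

/-- `C` is a sup-completion of the vector lattice `X`, where `ι` identifies `X`, with its
operations and its order, with the set of the invertible elements of `C`. -/
structure IsSupCompletion (X C : Type*) [AddCommGroup X] [Module ℝ X] [Lattice X]
    [AddCommMonoid C] [Module ℝ≥0 C] [Lattice C] (ι : X → C) : Prop where
  cone : IsSupCompletionCone C
  map_add : ∀ x y : X, ι (x + y) = ι x + ι y
  map_smul : ∀ (r : ℝ≥0) (x : X), ι ((r : ℝ) • x) = r • ι x
  map_le_map_iff : ∀ x y : X, ι x ≤ ι y ↔ x ≤ y
  range_eq : Set.range ι = {a : C | IsAddUnit a}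

/-! The axiom that each `u` is the supremum of the elements `ι x ≤ u` reduces the claim to showing
`ι x ≤ w` for every upper bound `w` of the elements `ι (n • e) ⊓ u` and every `x` with `ι x ≤ u`;
since `0 ≤ u`, replacing `x` by its positive part keeps `ι x ≤ u`. As `w ⊓ ι x` lies below an
invertible element, it is itself of the form `ι z`, and `z` is an upper bound of all
`n • e ⊓ x` in `X`. The claim then follows from the classical fact
`IsWeakUnit.le_of_forall_nsmul_inf_le` that `x` is the supremum of `n • e ⊓ x` in `X`: the vector `d = (x - z) ⊓ e`
satisfies `n • d ≤ x` for all `n`, hence vanishes because order completeness makes `X`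
Archimedean, and so `x - z` is disjoint from `e`. -/

theorem nonpos_of_forall_nsmul_le {X : Type*} [AddCommGroup X] [ConditionallyCompleteLattice X]
    [IsOrderedAddMonoid X] {d x : X} (h : ∀ n : ℕ, n • d ≤ x) : d ≤ 0 := by
  have hb : BddAbove (Set.range fun n : ℕ => n • d) := ⟨x, by rintro _ ⟨n, rfl⟩; exact h n⟩
  have hs : (⨆ n : ℕ, n • d) ≤ (⨆ n : ℕ, n • d) - d := ciSup_le fun n => by
    rw [le_sub_iff_add_le, ← succ_nsmul]
    exact le_ciSup hb (n + 1)
  simpa using hs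

/-- In an order complete vector lattice with weak unit `e`, every `x ≥ 0` is the supremum of the
vectors `n • e ⊓ x`. -/
theorem IsWeakUnit.le_of_forall_nsmul_inf_le {X : Type*} [AddCommGroup X]
    [ConditionallyCompleteLattice X] [IsOrderedAddMonoid X] {e : X} (he : IsWeakUnit e)
    {x z : X} (hx : 0 ≤ x) (hzx : z ≤ x) (h : ∀ n : ℕ, n • e ⊓ x ≤ z) : x ≤ z := by
  have hy : 0 ≤ x - z := sub_nonneg.2 hzx
  have hd : ∀ n : ℕ, n • ((x - z) ⊓ e) ≤ x := fun n => by
    induction n with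
    | zero => simpa using hx
    | succ n ih =>
      have hz : n • ((x - z) ⊓ e) ≤ z :=
        (le_inf (nsmul_le_nsmul_right inf_le_right n) ih).trans (h n)
      rw [succ_nsmul]
      exact (add_le_add hz inf_le_left).trans_eq (add_sub_cancel z x)
  have h0 : x - z = 0 := he.2 _ <| by
    rw [abs_of_nonneg hy]
    exact le_antisymm (nonpos_of_forall_nsmul_le hd) (le_inf hy he.1)
  exact (sub_eq_zero.1 h0).le

namespace IsSupCompletion

variable {X C : Type*} [AddCommGroup X] [Lattice X] [Module ℝ X]
  [AddCommMonoid C] [Module ℝ≥0 C] [Lattice C] {ι : X → C}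

theorem map_zero (hι : IsSupCompletion X C ι) : ι 0 = 0 := by
  simpa using hι.map_smul 0 0

theorem isAddUnit_map (hι : IsSupCompletion X C ι) (x : X) : IsAddUnit (ι x) := by
  have hx : ι x ∈ Set.range ι := ⟨x, rfl⟩
  rwa [hι.range_eq] at hx

/-- The image of `ι` is a lower set. -/
theorem exists_eq_of_le (hι : IsSupCompletion X C ι) {a : C} {x : X} (h : a ≤ ι x) :
    ∃ z, ι z = a := by
  have ha : a ∈ {a : C | IsAddUnit a} := hι.cone.isAddUnit_of_le a _ (hι.isAddUnit_map x) h
  rwa [← hι.range_eq] at ha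

/-- Suprema of two elements of `X` are the same in `X` and in `C`. -/
theorem map_sup_le (hι : IsSupCompletion X C ι) {x y : X} {a : C} (hx : ι x ≤ a)
    (hy : ι y ≤ a) : ι (x ⊔ y) ≤ a := by
  have hle : ι x ⊔ ι y ≤ ι (x ⊔ y) :=
    sup_le ((hι.map_le_map_iff _ _).2 le_sup_left) ((hι.map_le_map_iff _ _).2 le_sup_right)
  obtain ⟨z, hz⟩ := hι.exists_eq_of_le hle
  have hxz : x ⊔ y ≤ z := sup_le ((hι.map_le_map_iff _ _).1 (hz ▸ le_sup_left))
    ((hι.map_le_map_iff _ _).1 (hz ▸ le_sup_right))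
  exact ((hι.map_le_map_iff _ _).2 hxz).trans (hz ▸ sup_le hx hy)

end IsSupCompletion

theorem mainTheorem5 {X C : Type*} [AddCommGroup X] [ConditionallyCompleteLattice X]
    [IsOrderedAddMonoid X] [Module ℝ X] [IsOrderedModule ℝ X]
    [AddCommMonoid C] [Module ℝ≥0 C] [Lattice C]
    (ι : X → C) (hι : IsSupCompletion X C ι)
    (e : X) (he : IsWeakUnit e) (u : C) (hu : 0 ≤ u) :
    IsLUB (Set.range fun n : ℕ => ι (n • e) ⊓ u) u := by
  refine ⟨by rintro _ ⟨n, rfl⟩; exact inf_le_right, fun w hw => ?_⟩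
  refine (hι.cone.isLUB_addUnits_le u).2 ?_
  rintro a ⟨ha, hau⟩
  obtain ⟨x, rfl⟩ : a ∈ Set.range ι := by rw [hι.range_eq]; exact ha
  have hxu : ι (x ⊔ 0) ≤ u := hι.map_sup_le hau (hι.map_zero.trans_le hu)
  obtain ⟨z, hz⟩ := hι.exists_eq_of_le (inf_le_right : w ⊓ ι (x ⊔ 0) ≤ ι (x ⊔ 0))
  have hzx : z ≤ x ⊔ 0 := (hι.map_le_map_iff _ _).1 (hz ▸ inf_le_right)
  have hxz : x ⊔ 0 ≤ z := he.le_of_forall_nsmul_inf_le le_sup_right hzx fun n => by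
    rw [← hι.map_le_map_iff, hz]
    have hr : ι (n • e ⊓ (x ⊔ 0)) ≤ ι (x ⊔ 0) := (hι.map_le_map_iff _ _).2 inf_le_right
    exact le_inf ((le_inf ((hι.map_le_map_iff _ _).2 inf_le_left) (hr.trans hxu)).trans
      (hw ⟨n, rfl⟩)) hr
  exact ((hι.map_le_map_iff _ _).2 (le_sup_left.trans hxz)).trans (hz ▸ inf_le_left)
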